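/- Let $N\ge 1$ be an integer and $\tfrac12<s<1$ with $N>2s>1$. For $u\colon\mathbb R^N\to\mathbb R$ let $$(-\Delta)^s u(x)=C_{N,s}\lim_{\varepsilon\to0^+}\int_{\mathbb R^N\setminus B_\varepsilon(x)}\frac{u(x)-u(y)}{|x-y|^{N+2s}}\,dy ,\qquad C_{N,s}=\frac{4^s\,\Gamma(\frac N2+s)}{\pi^{N/2}|\Gamma(-s)|},$$ and let $\mathcal L_{2s}$ be the set of measurable $u$ with $\int_{\mathbb R^N}\frac{|u(x)|}{1+|x|^{N+2s}}\,dx<\infty$. For $R_0>0$ let $B_{R_0}$ be the open ball of radius $R_0$ centred at $0$. For $p,q,\lambda,R_0>0$, a positive bounded supersolution of $$(-\Delta)^s u+|\nabla u|^q=\lambda u^p\quad\text{in }\mathbb R^N\setminus B_{R_0}\tag{$*$}$$ is a function $u\in\mathcal L_{2s}$, positive and bounded on all of $\mathbb R^N$, of class $C^2$ in a neighbourhood of every point of $\mathbb R^N\setminus B_{R_0}$, such that at every $x\in\mathbb R^N\setminus B_{R_0}$ the limit defining $(-\Delta)^su(x)$ exists and $(-\Delta)^su(x)+|\nabla u(x)|^q\ge\lambda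 u(x)^p$. Then: (i) If $p=\frac N{N-2s}$ and $0<q<1$, then for all $R_0>0$ and all $\lambda>0$ there is a positive bounded supersolution of $(*)$. (ii) There is $\tilde R_0>0$, depending only on $N$ and $s$, such that if $p=\frac N{N-2s}$ and $q=1$, then for all $R_0>\tilde R_0$ and all $\lambda>0$ there is a positive bounded supersolution of $(*)$. (iii) If $p=\frac N{N-2s}$ and $1<q\le\frac N{N+1-2s}$, then for every $R_0>0$ there is $\lambda_0>0$ such that for all $\lambda\in(0,\lambda_0)$ there is a positive bounded supersolution of $(*)$. (iv) The conclusion of (iii) holds if $\frac{2s-1}{2s-q}\,q\le p<\frac N{N-2s}$ and $\frac{N+2s}{N+1}<q<\frac N{N+1-2s}$. (v) The conclusion of (iii) holds if $\frac{N+2s}{N+2s-q}\,q\le p<\frac N{N-2s}$, $0<q<\frac{N+2s}{N+1}$ and $q\ne1$. Moreover there is $\tilde R_0>0$, depending only on $N$ and $s$, such that if $q=1$ and $\frac{N+2s}{N+2s-1}\le p<\frac N{N-2s}$, then for every $R_0>\tilde R_0$ there is $\lambda_0>0$ such that for all $\lambda\in(0,\lambda_0)$ there is a positive bounded supersolution of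 $(*)$. (vi) The conclusion of (iii) holds if $\frac{N+2s}N<p<\frac N{N-2s}$ and $q=\frac{N+2s}{N+1}$. -/

import Mathlib

open MeasureTheory Filter Topology

noncomputable section

/-- The usual normalization constant `C_{N,s}` of the fractional Laplacian,
`4^s Γ(N/2+s) / (π^{N/2} |Γ(-s)|)`, written with `|Γ(-s)| = Γ(1-s)/s`. -/
def fracConst (N : ℕ) (s : ℝ) : ℝ :=
  4 ^ s * s * Real.Gamma ((N : ℝ) / 2 + s) / (Real.pi ^ ((N : ℝ) / 2) * Real.Gamma (1 - s))

/-- `(-Δ)^s u (x)` exists in the principal value sense and equals `v`: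
the truncated integrals over `ℝ^N ∖ B_ε(x)` converge absolutely, and
`C_{N,s} ∫_{ℝ^N ∖ B_ε(x)} (u x - u y) / |x - y|^{N+2s} dy → v` as `ε → 0+`. -/
def HasFracLaplacianAt {N : ℕ} (s : ℝ) (u : EuclideanSpace ℝ (Fin N) → ℝ)
    (v : ℝ) (x : EuclideanSpace ℝ (Fin N)) : Prop :=
  (∀ ε : ℝ, 0 < ε →
    IntegrableOn (fun y => (u x - u y) / ‖x - y‖ ^ ((N : ℝ) + 2 * s)) (Metric.ball x ε)ᶜ) ∧
  Tendsto
    (fun ε : ℝ => fracConst N s *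
      ∫ y in (Metric.ball x ε)ᶜ, (u x - u y) / ‖x - y‖ ^ ((N : ℝ) + 2 * s))
    (𝓝[>] 0) (𝓝 v)

/-- The weighted space `𝓛_{2s}`: `∫ |u x| / (1 + |x|^{N+2s}) dx < ∞`. -/
def MemL2s {N : ℕ} (s : ℝ) (u : EuclideanSpace ℝ (Fin N) → ℝ) : Prop :=
  Integrable (fun x => u x / (1 + ‖x‖ ^ ((N : ℝ) + 2 * s)))

/-- `u` is a classical supersolution of `(-Δ)^s u + |∇u|^q = f(u)` in `Ω`: `u ∈ 𝓛_{2s}` is `C²`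
near every point of `Ω`, and at every point of `Ω` the fractional Laplacian exists and
`(-Δ)^s u + |∇u|^q ≥ f(u)`. -/
structure IsClassicalSupersolution {N : ℕ} (s q : ℝ) (f : ℝ → ℝ)
    (Ω : Set (EuclideanSpace ℝ (Fin N))) (u : EuclideanSpace ℝ (Fin N) → ℝ) : Prop where
  contDiffAt : ∀ x ∈ Ω, ContDiffAt ℝ 2 u x
  memL2s : MemL2s s u
  supersol : ∀ x ∈ Ω, ∃ v : ℝ, HasFracLaplacianAt s u v x ∧ f (u x) ≤ v + ‖gradient u x‖ ^ q

/-- There is a classical supersolution of `(-Δ)^s u + |∇u|^q = lam * u^p` in `ℝ^N ∖ B_{R₀}`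
that is positive and bounded on all of `ℝ^N`. -/
def ExistsPosBddSupersolution (N : ℕ) (s p q lam R₀ : ℝ) : Prop :=
  ∃ u : EuclideanSpace ℝ (Fin N) → ℝ,
    (∀ x, 0 < u x) ∧ (∃ M : ℝ, ∀ x, u x ≤ M) ∧
    IsClassicalSupersolution s q (fun t => lam * t ^ p) (Metric.ball 0 R₀)ᶜ u

end

/-! Every supersolution is a single explicit profile `u(x) = A ⟨x/R⟩^(-σ)` with `⟨y⟩ = √(1+|y|²)`,
smooth on the whole space. With `y = x/R`, three decay rates compete. The fractional Laplacian is at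
least `-K A R^(-2s) ⟨y⟩^(-(min(σ,N)+2s))` when `σ ≠ N` (`exists_hasFracLaplacianAt_bracketProfile`).
The gradient is comparable to `A R⁻¹ ⟨y⟩^(-(σ+1))` away from the origin. The reaction is `λ A^p
⟨y⟩^(-σp)`.

If `(σ+1)q ≤ min(σ,N)+2s` and `(σ+1)q ≤ σp`, the gradient term decays slowest, and the inequality
reduces to one between constants, `A R^(-2s) K + λ A^p ≤ (A R⁻¹ σ κ)^q`
(`exists_supersolution_of_amplitude`).

The constants are then matched. For `q ≠ 1` the gradient beats the diffusion by taking `A` large (`q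
> 1`) or small (`q < 1`), and a small `λ` absorbs the reaction. For `q < 1`, `q < p`, letting `A →
0` handles every `λ`. For `q = 1` diffusion and gradient scale alike in `A`, so `R` must be large
instead; this uses `2s > 1` and forces `R₀` to be large. What remains in each regime is the choice
of `σ`. -/

/-! ### Integrability and scaling of powers of the norm. -/

lemma integrableOn_norm_rpow_ball {N : ℕ} (hN : 2 ≤ N) {a : ℝ} (ha : a < N) (ρ : ℝ) :
    IntegrableOn (fun z : EuclideanSpace ℝ (Fin N) => ‖z‖ ^ (-a)) (Metric.ball 0 ρ) := by
  have : Nonempty (Fin N) := ⟨⟨0, by omega⟩⟩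
  rcases le_or_gt ρ 0 with hρ | hρ
  · simp [Metric.ball_eq_empty.2 hρ]
  rw [integrableOn_fun_norm_addHaar volume (f := fun t : ℝ => t ^ (-a))]
  have h := (intervalIntegral.integrableOn_Ioo_rpow_iff (s := (N : ℝ) - 1 - a) hρ).2 (by linarith)
  refine h.congr_fun (fun y hy => ?_) measurableSet_Ioo
  have hy0 : 0 < y := hy.1
  have hc : ((N : ℝ) - 1) = ((N - 1 : ℕ) : ℝ) := by
    rw [Nat.cast_sub (by omega)]; simp
  simp only [finrank_euclideanSpace, Fintype.card_fin, smul_eq_mul]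
  rw [sub_eq_add_neg _ a, Real.rpow_add hy0, hc, Real.rpow_natCast]

lemma integrableOn_norm_rpow_compl_ball {N : ℕ} {a : ℝ} (ha : N < a) {ρ : ℝ} (hρ : 0 < ρ) :
    IntegrableOn (fun z : EuclideanSpace ℝ (Fin N) => ‖z‖ ^ (-a)) (Metric.ball 0 ρ)ᶜ := by
  have h0 : Integrable (fun z : EuclideanSpace ℝ (Fin N) => (1 + ‖z‖) ^ (-a)) :=
    integrable_one_add_norm (by simpa using ha)
  refine ((h0.const_mul ((1 + 1 / ρ) ^ a)).integrableOn (s := (Metric.ball 0 ρ)ᶜ)).mono'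
    (Measurable.aestronglyMeasurable (by fun_prop)) ?_
  refine (ae_restrict_iff' Metric.isOpen_ball.measurableSet.compl).2 (ae_of_all _ fun z hz => ?_)
  have hz' : ρ ≤ ‖z‖ := by simpa using hz
  have hzp : 0 < ‖z‖ := hρ.trans_le hz'
  have ha0 : 0 ≤ a := (Nat.cast_nonneg N).trans ha.le
  rw [Real.norm_of_nonneg (by positivity)]
  have h1 : 1 + ‖z‖ ≤ (1 + 1 / ρ) * ‖z‖ := by
    have : 1 ≤ 1 / ρ * ‖z‖ := by rw [one_div, inv_mul_eq_div, le_div_iff₀ hρ]; linarith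
    linarith
  have h2 : (1 + ‖z‖) ^ a ≤ (1 + 1 / ρ) ^ a * ‖z‖ ^ a := by
    rw [← Real.mul_rpow (by positivity) hzp.le]
    exact Real.rpow_le_rpow (by positivity) h1 ha0
  rw [Real.rpow_neg hzp.le, Real.rpow_neg (by positivity), ← div_eq_mul_inv,
    le_div_iff₀ (by positivity), inv_mul_le_iff₀ (by positivity)]
  linarith

open Pointwise in
lemma setIntegral_smul_norm_rpow {N : ℕ} (a : ℝ) (S : Set (EuclideanSpace ℝ (Fin N)))
    {ρ : ℝ} (hρ : 0 < ρ) :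
    ∫ z in ρ • S, ‖z‖ ^ (-a) = ρ ^ ((N : ℝ) - a) * ∫ z in S, ‖z‖ ^ (-a) := by
  have h := Measure.setIntegral_comp_smul_of_pos volume
    (fun z : EuclideanSpace ℝ (Fin N) => ‖z‖ ^ (-a)) S hρ
  simp only [norm_smul, Real.norm_of_nonneg hρ.le, finrank_euclideanSpace, Fintype.card_fin,
    smul_eq_mul] at h
  have h2 : ∀ z : EuclideanSpace ℝ (Fin N), (ρ * ‖z‖) ^ (-a) = ρ ^ (-a) * ‖z‖ ^ (-a) :=
    fun z => Real.mul_rpow hρ.le (norm_nonneg _)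
  simp only [h2, integral_const_mul] at h
  rw [sub_eq_add_neg, Real.rpow_add hρ, Real.rpow_natCast, mul_assoc, h,
    mul_inv_cancel_left₀ (by positivity)]

open Pointwise in
lemma setIntegral_ball_norm_rpow {N : ℕ} (a : ℝ) {ρ : ℝ} (hρ : 0 < ρ) :
    ∫ z in Metric.ball (0 : EuclideanSpace ℝ (Fin N)) ρ, ‖z‖ ^ (-a) =
      ρ ^ ((N : ℝ) - a) * ∫ z in Metric.ball (0 : EuclideanSpace ℝ (Fin N)) 1, ‖z‖ ^ (-a) := by
  rw [← setIntegral_smul_norm_rpow a _ hρ, smul_unitBall hρ.ne', Real.norm_of_nonneg hρ.le]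

open Pointwise in
lemma setIntegral_compl_ball_norm_rpow {N : ℕ} (a : ℝ) {ρ : ℝ} (hρ : 0 < ρ) :
    ∫ z in (Metric.ball (0 : EuclideanSpace ℝ (Fin N)) ρ)ᶜ, ‖z‖ ^ (-a) =
      ρ ^ ((N : ℝ) - a) *
        ∫ z in (Metric.ball (0 : EuclideanSpace ℝ (Fin N)) 1)ᶜ, ‖z‖ ^ (-a) := by
  rw [← setIntegral_smul_norm_rpow a _ hρ, show ρ • (Metric.ball (0 : EuclideanSpace ℝ (Fin N)) 1)ᶜ = (ρ • Metric.ball 0 1)ᶜ from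
      Set.smul_set_compl (a := Units.mk0 ρ hρ.ne'), smul_unitBall hρ.ne',
    Real.norm_of_nonneg hρ.le]

/-! ### The principal value as an absolutely convergent integral. -/

/-- The symmetric second difference quotient of `u` at `x`, whose integral is twice the
principal value in the fractional Laplacian. -/
noncomputable def secondDiffQuot {N : ℕ} (a : ℝ) (u : EuclideanSpace ℝ (Fin N) → ℝ)
    (x z : EuclideanSpace ℝ (Fin N)) : ℝ :=
  (2 * u x - u (x + z) - u (x - z)) * ‖z‖ ^ (-a)

lemma integrable_secondDiffQuot {N : ℕ} (hN : 2 ≤ N) {a : ℝ} (ha : N < a) (ha2 : a < N + 2)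
    {u : EuclideanSpace ℝ (Fin N) → ℝ} (hu : Continuous u) {M : ℝ} (hM : ∀ y, |u y| ≤ M)
    {x : EuclideanSpace ℝ (Fin N)} {C δ : ℝ} (hδ : 0 < δ)
    (hC : ∀ z, ‖z‖ < δ → |2 * u x - u (x + z) - u (x - z)| ≤ C * ‖z‖ ^ 2) :
    Integrable (secondDiffQuot a u x) := by
  have hmeas : Measurable (secondDiffQuot a u x) := by
    unfold secondDiffQuot
    have := hu.measurable
    fun_prop
  rw [← integrableOn_univ, ← Set.union_compl_self (Metric.ball (0 : EuclideanSpace ℝ (Fin N)) δ)]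
  refine IntegrableOn.union ?_ ?_
  · refine ((integrableOn_norm_rpow_ball hN (a := a - 2) (by linarith) δ).const_mul C).mono'
      hmeas.aestronglyMeasurable ?_
    refine (ae_restrict_iff' Metric.isOpen_ball.measurableSet).2 (ae_of_all _ fun z hz => ?_)
    have hz' : ‖z‖ < δ := by simpa using hz
    rw [secondDiffQuot, Real.norm_eq_abs, abs_mul, abs_of_nonneg (a := ‖z‖ ^ (-a)) (by positivity)]
    -- The origin is not discarded: `0 ^ c = 0` for real `c ≠ 0`, so the bound holds there too.
    rcases eq_or_ne z 0 with rfl | hz0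
    · simp [Real.zero_rpow (show -a ≠ 0 by
        have : (0 : ℝ) ≤ N := Nat.cast_nonneg N
        linarith)]
      rcases eq_or_ne (2 - a) 0 with h | h
      · have : 2 - a ≠ 0 := by
          have : (2 : ℝ) ≤ N := by exact_mod_cast hN
          linarith
        exact absurd h this
      · simp [Real.zero_rpow h]
    have hzp : 0 < ‖z‖ := norm_pos_iff.2 hz0
    have h := mul_le_mul_of_nonneg_right (hC z hz') (Real.rpow_nonneg hzp.le (-a))
    refine h.trans (le_of_eq ?_)
    rw [mul_assoc, ← Real.rpow_natCast, ← Real.rpow_add hzp]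
    congr 2
    push_cast; ring
  · refine ((integrableOn_norm_rpow_compl_ball ha hδ).const_mul (4 * M)).mono'
      hmeas.aestronglyMeasurable (ae_of_all _ fun z => ?_)
    rw [secondDiffQuot, Real.norm_eq_abs, abs_mul, abs_of_nonneg (a := ‖z‖ ^ (-a)) (by positivity)]
    refine mul_le_mul_of_nonneg_right ?_ (by positivity)
    have h1 := abs_le.1 (hM x)
    have h2 := abs_le.1 (hM (x + z))
    have h3 := abs_le.1 (hM (x - z))
    rw [abs_le]
    constructor <;> linarith [h1.1, h1.2]

/-- Averaging a truncated integral with its image under `z ↦ -z` turns the integrand into half the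
second difference quotient. That quotient is integrable, so dominated convergence removes the
truncation. -/
lemma hasFracLaplacianAt_of_secondDiffQuot {N : ℕ} {s : ℝ} (hs : 0 < s)
    {u : EuclideanSpace ℝ (Fin N) → ℝ} (hu : Continuous u) {M : ℝ} (hM : ∀ y, |u y| ≤ M)
    {x : EuclideanSpace ℝ (Fin N)}
    (hint : Integrable (secondDiffQuot (N + 2 * s) u x)) :
    HasFracLaplacianAt s u
      (fracConst N s * ((∫ z, secondDiffQuot (N + 2 * s) u x z) / 2)) x := by
  set a : ℝ := N + 2 * s with ha
  have haN : (N : ℝ) < a := by linarith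
  have hball : ∀ ε : ℝ, MeasurableSet (Metric.ball (0 : EuclideanSpace ℝ (Fin N)) ε)ᶜ :=
    fun ε => Metric.isOpen_ball.measurableSet.compl
  have hint' : ∀ ε : ℝ, 0 < ε → IntegrableOn
      (fun z => (u x - u (x - z)) / ‖z‖ ^ a) (Metric.ball 0 ε)ᶜ := by
    intro ε hε
    refine ((integrableOn_norm_rpow_compl_ball haN hε).const_mul (2 * M)).mono' ?_
      (ae_of_all _ fun z => ?_)
    · have := hu.measurable
      exact Measurable.aestronglyMeasurable (by fun_prop)
    · rw [div_eq_mul_inv, ← Real.rpow_neg (norm_nonneg _), Real.norm_eq_abs, abs_mul,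
        abs_of_nonneg (a := ‖z‖ ^ (-a)) (by positivity)]
      refine mul_le_mul_of_nonneg_right ?_ (by positivity)
      have h1 := abs_le.1 (hM x)
      have h3 := abs_le.1 (hM (x - z))
      rw [abs_le]
      constructor <;> linarith [h1.1, h1.2]
  have hind : ∀ ε : ℝ, ∀ z, (Metric.ball x ε)ᶜ.indicator (fun y => (u x - u y) / ‖x - y‖ ^ a) (x - z)
      = (Metric.ball 0 ε)ᶜ.indicator (fun z => (u x - u (x - z)) / ‖z‖ ^ a) z := by
    intro ε z
    by_cases hz : ‖z‖ < ε <;> simp [Set.indicator, hz, dist_eq_norm]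
  have hind' : ∀ ε : ℝ, ∀ z, (Metric.ball 0 ε)ᶜ.indicator (fun z => (u x - u (x - z)) / ‖z‖ ^ a) (-z)
      = (Metric.ball 0 ε)ᶜ.indicator (fun z => (u x - u (x + z)) / ‖z‖ ^ a) z := by
    intro ε z
    by_cases hz : ‖z‖ < ε <;> simp [Set.indicator, hz]
  have hballx : ∀ ε : ℝ, MeasurableSet (Metric.ball x ε)ᶜ :=
    fun ε => Metric.isOpen_ball.measurableSet.compl
  refine ⟨fun ε hε => ?_, ?_⟩
  · rw [← integrable_indicator_iff (hballx ε)]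
    have h := ((integrable_indicator_iff (hball ε)).2 (hint' ε hε)).comp_sub_left x
    refine h.congr (ae_of_all _ fun y => ?_)
    simp only
    rw [← hind, sub_sub_cancel]
  · refine Tendsto.const_mul _ ?_
    have hlim : Tendsto (fun ε : ℝ => ∫ z, (Metric.ball 0 ε)ᶜ.indicator (secondDiffQuot a u x) z)
        (𝓝[>] 0) (𝓝 (∫ z, secondDiffQuot a u x z)) := by
      refine tendsto_integral_filter_of_dominated_convergence (fun z => ‖secondDiffQuot a u x z‖)
        (Eventually.of_forall fun ε => hint.aestronglyMeasurable.indicator (hball ε))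
        (Eventually.of_forall fun ε => ae_of_all _ fun z => norm_indicator_le_norm_self _ _)
        hint.norm (ae_of_all _ fun z => ?_)
      rcases eq_or_ne z 0 with rfl | hz
      · have h0 : secondDiffQuot a u x 0 = 0 := by simp [secondDiffQuot, two_mul]
        refine tendsto_const_nhds.congr fun ε => ?_
        by_cases h : (0 : EuclideanSpace ℝ (Fin N)) ∈ (Metric.ball 0 ε)ᶜ <;>
          simp [Set.indicator, h, h0]
      · refine tendsto_const_nhds.congr' ?_
        have : ∀ᶠ ε : ℝ in 𝓝[>] 0, ε < ‖z‖ :=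
          mem_nhdsWithin_of_mem_nhds (Iio_mem_nhds (norm_pos_iff.2 hz))
        filter_upwards [this] with ε hε
        rw [Set.indicator_of_mem]
        simpa using hε.le
    refine (hlim.div_const 2).congr' ?_
    filter_upwards [self_mem_nhdsWithin] with ε hε
    have e1 : ∫ y in (Metric.ball x ε)ᶜ, (u x - u y) / ‖x - y‖ ^ a
        = ∫ z, (Metric.ball 0 ε)ᶜ.indicator (fun z => (u x - u (x - z)) / ‖z‖ ^ a) z := by
      rw [← integral_indicator (hballx ε), ← integral_sub_left_eq_self _ volume x]
      exact integral_congr_ae (ae_of_all _ fun z => hind ε z)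
    have e2 : ∫ y in (Metric.ball x ε)ᶜ, (u x - u y) / ‖x - y‖ ^ a
        = ∫ z, (Metric.ball 0 ε)ᶜ.indicator (fun z => (u x - u (x + z)) / ‖z‖ ^ a) z := by
      rw [e1, ← integral_neg_eq_self]
      exact integral_congr_ae (ae_of_all _ fun z => hind' ε z)
    have i1 := (integrable_indicator_iff (hball ε)).2 (hint' ε hε)
    have i2 : Integrable
        ((Metric.ball 0 ε)ᶜ.indicator (fun z => (u x - u (x + z)) / ‖z‖ ^ a)) :=
      i1.comp_neg.congr (ae_of_all _ fun z => hind' ε z)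
    rw [div_eq_iff two_ne_zero, mul_two]
    nth_rewrite 1 [e1]
    rw [e2, ← integral_add i1 i2]
    refine integral_congr_ae (ae_of_all _ fun z => ?_)
    by_cases h : z ∈ (Metric.ball (0 : EuclideanSpace ℝ (Fin N)) ε)ᶜ
    · simp only [Set.indicator_of_mem h, secondDiffQuot]
      rw [Real.rpow_neg (norm_nonneg _)]
      ring
    · simp only [Set.indicator_of_notMem h, add_zero]

/-! ### Second differences of powers of the Japanese bracket. -/

/-- Quadratic Taylor estimate for `t ↦ (1 + t) ^ (-b)` near `0`. -/
lemma exists_abs_one_add_rpow_sub_le (b : ℝ) :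
    ∃ C : ℝ, 0 ≤ C ∧ ∀ t : ℝ, |t| ≤ 9 / 16 → |(1 + t) ^ (-b) - 1 + b * t| ≤ C * t ^ 2 := by
  set S : Set ℝ := Set.Icc (-(9 / 16)) (9 / 16) with hS
  have hpos : ∀ t ∈ S, 0 < 1 + t := fun t ht => by linarith [ht.1]
  have hd : ∀ c : ℝ, ∀ t ∈ S, HasDerivAt (fun t : ℝ => (1 + t) ^ c) (c * (1 + t) ^ (c - 1)) t := by
    intro c t ht
    have := ((hasDerivAt_id t).const_add 1).rpow_const (p := c) (Or.inl (hpos t ht).ne')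
    simpa using this
  have hcont : ContinuousOn (fun t : ℝ => -b * ((-b - 1) * (1 + t) ^ (-b - 1 - 1))) S := by
    refine ContinuousOn.mul continuousOn_const (ContinuousOn.mul continuousOn_const ?_)
    exact fun t ht => (hd _ t ht).continuousAt.continuousWithinAt
  obtain ⟨C, hC⟩ := isCompact_Icc.exists_bound_of_continuousOn hcont
  have h0 : (0 : ℝ) ∈ S := ⟨by norm_num, by norm_num⟩
  have hC0 : 0 ≤ C := (norm_nonneg _).trans (hC 0 h0)
  refine ⟨C, hC0, fun t ht => ?_⟩
  have hder : ∀ τ ∈ S, |-b * (1 + τ) ^ (-b - 1) + b| ≤ C * |τ| := by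
    intro τ hτ
    have := (convex_Icc (-(9 / 16) : ℝ) (9 / 16)).norm_image_sub_le_of_norm_hasDerivWithin_le
      (f := fun τ : ℝ => -b * (1 + τ) ^ (-b - 1))
      (fun x hx => ((hd (-b - 1) x hx).const_mul (-b)).hasDerivWithinAt) hC h0 hτ
    simpa using this
  -- On this smaller interval the derivative is at most `C|t|`, so a second use of the mean value
  -- inequality gives `C t²`.
  have hsub : Set.Icc (-|t|) |t| ⊆ S := Set.Icc_subset_Icc (by linarith) ht
  have := (convex_Icc (-|t|) |t|).norm_image_sub_le_of_norm_hasDerivWithin_le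
      (f := fun τ : ℝ => (1 + τ) ^ (-b) + b * τ)
      (f' := fun τ : ℝ => -b * (1 + τ) ^ (-b - 1) + b) (C := C * |t|)
      (fun x hx => by
        have h := (hd (-b) x (hsub hx)).add ((hasDerivAt_id x).const_mul b)
        simp only [mul_one] at h
        exact h.hasDerivWithinAt)
      (fun x hx => (hder x (hsub hx)).trans
        (mul_le_mul_of_nonneg_left (abs_le.2 hx) hC0))
      (show (0 : ℝ) ∈ Set.Icc (-|t|) |t| from ⟨by simp, by simp⟩)
      (show t ∈ Set.Icc (-|t|) |t| from ⟨neg_abs_le t, le_abs_self t⟩)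
  simp only [add_zero, mul_zero, Real.one_rpow, sub_zero, Real.norm_eq_abs] at this
  rw [mul_assoc, abs_mul_abs_self, ← sq] at this
  convert this using 2
  ring

/-- The Japanese bracket `√(1 + |x|²)`. -/
noncomputable def japaneseBracket {N : ℕ} (x : EuclideanSpace ℝ (Fin N)) : ℝ :=
  Real.sqrt (1 + ‖x‖ ^ 2)

lemma japaneseBracket_sq {N : ℕ} (x : EuclideanSpace ℝ (Fin N)) :
    japaneseBracket x ^ 2 = 1 + ‖x‖ ^ 2 := Real.sq_sqrt (by positivity)

lemma one_le_japaneseBracket {N : ℕ} (x : EuclideanSpace ℝ (Fin N)) :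
    1 ≤ japaneseBracket x := Real.one_le_sqrt.2 (by linarith [sq_nonneg ‖x‖])

lemma japaneseBracket_pos {N : ℕ} (x : EuclideanSpace ℝ (Fin N)) :
    0 < japaneseBracket x := one_pos.trans_le (one_le_japaneseBracket x)

lemma norm_le_japaneseBracket {N : ℕ} (x : EuclideanSpace ℝ (Fin N)) :
    ‖x‖ ≤ japaneseBracket x := Real.le_sqrt_of_sq_le (by linarith)

lemma japaneseBracket_rpow {N : ℕ} (x : EuclideanSpace ℝ (Fin N)) (c : ℝ) :
    japaneseBracket x ^ c = (1 + ‖x‖ ^ 2) ^ (c / 2) := by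
  rw [← japaneseBracket_sq, ← Real.rpow_natCast, ← Real.rpow_mul (japaneseBracket_pos x).le]
  congr 1
  push_cast; ring

lemma continuous_japaneseBracket_rpow {N : ℕ} (c : ℝ) :
    Continuous fun x : EuclideanSpace ℝ (Fin N) => japaneseBracket x ^ c := by
  refine Continuous.rpow_const ?_ fun x => Or.inl (japaneseBracket_pos x).ne'
  unfold japaneseBracket
  fun_prop

lemma japaneseBracket_rpow_neg_le_one {N : ℕ} {σ : ℝ} (hσ : 0 ≤ σ)
    (x : EuclideanSpace ℝ (Fin N)) : japaneseBracket x ^ (-σ) ≤ 1 :=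
  Real.rpow_le_one_of_one_le_of_nonpos (one_le_japaneseBracket x) (by linarith)

lemma abs_japaneseBracket_rpow_neg_le_one {N : ℕ} {σ : ℝ} (hσ : 0 ≤ σ)
    (x : EuclideanSpace ℝ (Fin N)) : |japaneseBracket x ^ (-σ)| ≤ 1 := by
  rw [abs_of_pos (Real.rpow_pos_of_pos (japaneseBracket_pos x) _)]
  exact japaneseBracket_rpow_neg_le_one hσ x

/-- Second differences of `⟨x⟩ ^ (-σ)` decay two orders faster than the function. -/
lemma exists_secondDiff_japaneseBracket_le (N : ℕ) (σ : ℝ) :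
    ∃ C : ℝ, 0 ≤ C ∧ ∀ x z : EuclideanSpace ℝ (Fin N), ‖z‖ ≤ japaneseBracket x / 4 →
      |2 * japaneseBracket x ^ (-σ) - japaneseBracket (x + z) ^ (-σ)
        - japaneseBracket (x - z) ^ (-σ)| ≤ C * japaneseBracket x ^ (-σ - 2) * ‖z‖ ^ 2 := by
  obtain ⟨C, hC0, hC⟩ := exists_abs_one_add_rpow_sub_le (σ / 2)
  refine ⟨|σ| + C * 162 / 16, by positivity, fun x z hz => ?_⟩
  set r := japaneseBracket x with hr
  have hr1 : 1 ≤ r := one_le_japaneseBracket x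
  have hr0 : 0 < r := japaneseBracket_pos x
  have hxr : ‖x‖ ≤ r := norm_le_japaneseBracket x
  have hz0 := norm_nonneg z
  have hx0 := norm_nonneg x
  set n := ‖z‖ with hn
  have hr2 : 1 + ‖x‖ ^ 2 = r ^ 2 := (japaneseBracket_sq x).symm
  -- Write `⟨x+w⟩² = r²(1+t)`. Since `n ≤ r/4` and `|x| ≤ r`, `|t| ≤ (n/4 + 2n)/r = 9n/(4r) ≤ 9/16`,
  -- which is the range of the Taylor estimate. The parts of `t` linear in `w` cancel between `z`
  -- and `-z`.
  have key : ∀ w : EuclideanSpace ℝ (Fin N), ‖w‖ = n →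
      ∃ t, t = (n ^ 2 + 2 * inner ℝ x w) / r ^ 2 ∧ |t| ≤ 9 / 4 * n / r ∧ |t| ≤ 9 / 16 ∧
        japaneseBracket (x + w) ^ (-σ) = r ^ (-σ) * (1 + t) ^ (-(σ / 2)) := by
    intro w hw
    refine ⟨_, rfl, ?_⟩
    have hin : |inner ℝ x w| ≤ ‖x‖ * n := hw ▸ abs_real_inner_le_norm x w
    have hnum : |n ^ 2 + 2 * inner ℝ x w| ≤ 9 / 4 * n * r := by
      refine (abs_add_le _ _).trans ?_
      rw [abs_of_nonneg (sq_nonneg n), abs_mul, abs_two]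
      have : ‖x‖ * n ≤ r * n := mul_le_mul_of_nonneg_right hxr hz0
      nlinarith
    have h1 : |(n ^ 2 + 2 * inner ℝ x w) / r ^ 2| ≤ 9 / 4 * n / r := by
      rw [abs_div, abs_of_pos (a := r ^ 2) (by positivity), div_le_div_iff₀ (by positivity) hr0]
      nlinarith
    have h2 : 9 / 4 * n / r ≤ 9 / 16 := by
      rw [div_le_iff₀ hr0]; linarith
    refine ⟨h1, h1.trans h2, ?_⟩
    have h3 := abs_le.1 (h1.trans h2)
    have : 1 + ‖x + w‖ ^ 2 = r ^ 2 * (1 + (n ^ 2 + 2 * inner ℝ x w) / r ^ 2) := by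
      rw [norm_add_sq_real, hw, mul_add, mul_div_cancel₀ _ (by positivity)]
      linarith
    rw [japaneseBracket_rpow, this, Real.mul_rpow (by positivity) (by linarith [h3.1]), neg_div]
    congr 1
    rw [← Real.rpow_natCast, ← Real.rpow_mul hr0.le]
    congr 1
    push_cast; ring
  obtain ⟨t₁, ht₁, hb₁, hc₁, he₁⟩ := key z rfl
  obtain ⟨t₂, ht₂, hb₂, hc₂, he₂⟩ := key (-z) (norm_neg z)
  rw [← sub_eq_add_neg] at he₂
  rw [inner_neg_right] at ht₂
  have hsum : t₁ + t₂ = 2 * n ^ 2 / r ^ 2 := by rw [ht₁, ht₂]; ring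
  have hsq : ∀ t : ℝ, |t| ≤ 9 / 4 * n / r → t ^ 2 ≤ 81 / 16 * n ^ 2 / r ^ 2 := by
    intro t ht
    have := pow_le_pow_left₀ (abs_nonneg t) ht 2
    rw [sq_abs] at this
    refine this.trans (le_of_eq ?_)
    ring
  have hrr : r ^ (-σ - 2) = r ^ (-σ) / r ^ 2 := by
    rw [Real.rpow_sub hr0, Real.rpow_two]
  rw [he₁, he₂, hrr]
  have e : 2 * r ^ (-σ) - r ^ (-σ) * (1 + t₁) ^ (-(σ / 2)) - r ^ (-σ) * (1 + t₂) ^ (-(σ / 2))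
      = r ^ (-σ) * (σ / 2 * (t₁ + t₂) - ((1 + t₁) ^ (-(σ / 2)) - 1 + σ / 2 * t₁)
        - ((1 + t₂) ^ (-(σ / 2)) - 1 + σ / 2 * t₂)) := by ring
  rw [e, abs_mul, abs_of_pos (Real.rpow_pos_of_pos hr0 _)]
  have e2 : (|σ| + C * 162 / 16) * (r ^ (-σ) / r ^ 2) * n ^ 2
      = r ^ (-σ) * (|σ| * (n ^ 2 / r ^ 2) + C * (81 / 16 * n ^ 2 / r ^ 2)
        + C * (81 / 16 * n ^ 2 / r ^ 2)) := by ring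
  rw [e2]
  refine mul_le_mul_of_nonneg_left ?_ (Real.rpow_nonneg hr0.le _)
  have hA : |σ / 2 * (t₁ + t₂)| = |σ| * (n ^ 2 / r ^ 2) := by
    rw [hsum, abs_mul, abs_div, abs_two, abs_of_nonneg (a := 2 * n ^ 2 / r ^ 2) (by positivity)]
    ring
  have hB := (hC t₁ hc₁).trans (mul_le_mul_of_nonneg_left (hsq t₁ hb₁) hC0)
  have hD := (hC t₂ hc₂).trans (mul_le_mul_of_nonneg_left (hsq t₂ hb₂) hC0)
  refine (abs_sub _ _).trans (add_le_add ((abs_sub _ _).trans (add_le_add hA.le hB)) hD)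

/-! ### Lower bound for the fractional Laplacian of the bracket power. -/

lemma integrable_japaneseBracket_rpow {N : ℕ} {σ : ℝ} (hσ : N < σ) :
    Integrable (fun y : EuclideanSpace ℝ (Fin N) => japaneseBracket y ^ (-σ)) := by
  refine (integrable_rpow_neg_one_add_norm_sq (r := σ) (by simpa using hσ)).congr
    (ae_of_all _ fun y => ?_)
  simp only
  rw [japaneseBracket_rpow]

/-- For `σ < N` compare with `|y|^(-σ)` and scale; for `σ > N` the total mass is finite. At `σ = N`
a logarithm appears, hence the exclusion. -/
lemma exists_setIntegral_ball_japaneseBracket_le {N : ℕ} (hN : 2 ≤ N) {σ : ℝ} (hσ0 : 0 < σ)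
    (hσ : σ ≠ N) :
    ∃ C : ℝ, 0 ≤ C ∧ ∀ r : ℝ, 1 ≤ r →
      ∫ y in Metric.ball (0 : EuclideanSpace ℝ (Fin N)) r, japaneseBracket y ^ (-σ)
        ≤ C * r ^ ((N : ℝ) - min σ N) := by
  have hnn : ∀ y : EuclideanSpace ℝ (Fin N), 0 ≤ japaneseBracket y ^ (-σ) :=
    fun y => Real.rpow_nonneg (japaneseBracket_pos y).le _
  rcases lt_or_gt_of_ne hσ with h | h
  · refine ⟨∫ z in Metric.ball (0 : EuclideanSpace ℝ (Fin N)) 1, ‖z‖ ^ (-σ),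
      integral_nonneg fun z => by positivity, fun r hr => ?_⟩
    have hr0 : 0 < r := by linarith
    rw [min_eq_left h.le, mul_comm, ← setIntegral_ball_norm_rpow σ hr0]
    have : Nonempty (Fin N) := ⟨⟨0, by omega⟩⟩
    refine setIntegral_mono_ae ?_ (integrableOn_norm_rpow_ball hN h r) ?_
    · exact ((continuous_japaneseBracket_rpow (-σ)).continuousOn.integrableOn_compact
        (isCompact_closedBall 0 r)).mono_set Metric.ball_subset_closedBall
    · filter_upwards [compl_mem_ae_iff.2 (measure_singleton (0 : EuclideanSpace ℝ (Fin N)))]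
        with y hy
      have hy0 : 0 < ‖y‖ := norm_pos_iff.2 hy
      exact Real.rpow_le_rpow_of_nonpos hy0 (norm_le_japaneseBracket y) (by linarith)
  · refine ⟨∫ y : EuclideanSpace ℝ (Fin N), japaneseBracket y ^ (-σ), integral_nonneg hnn,
      fun r hr => ?_⟩
    rw [min_eq_right h.le, sub_self, Real.rpow_zero, mul_one]
    exact setIntegral_le_integral (integrable_japaneseBracket_rpow h) (ae_of_all _ hnn)

lemma integrable_secondDiffQuot_japaneseBracket {N : ℕ} (hN : 2 ≤ N) {s σ : ℝ} (hs : 0 < s)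
    (hs1 : s < 1) (hσ : 0 ≤ σ) (x : EuclideanSpace ℝ (Fin N)) :
    Integrable (secondDiffQuot (N + 2 * s) (fun y => japaneseBracket y ^ (-σ)) x) := by
  obtain ⟨C, hC0, hC⟩ := exists_secondDiff_japaneseBracket_le N σ
  exact integrable_secondDiffQuot hN (by linarith) (by linarith)
    (continuous_japaneseBracket_rpow _) (abs_japaneseBracket_rpow_neg_le_one hσ)
    (div_pos (japaneseBracket_pos x) four_pos) (fun z hz => hC x z hz.le)

/-- Split at `|z| = r/4`, where `r = ⟨x⟩`. The near part is `O(r^(-σ-2s))` by the second difference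
estimate. In the far part `u(x)` has the favourable sign and is dropped. The values `u(x±z)`
contribute `O(r^(-σ-2s))` where `|x±z| ≥ r`, and at most `r^(-N-2s)` times the mass of `u` in the
ball of radius `r`, up to a constant, elsewhere. This last term brings in `min σ N`. -/
lemma exists_integral_secondDiffQuot_japaneseBracket_ge {N : ℕ} (hN : 2 ≤ N) {s σ : ℝ}
    (hs : 0 < s) (hs1 : s < 1) (hσ0 : 0 < σ) (hσ : σ ≠ N) :
    ∃ K : ℝ, 0 ≤ K ∧ ∀ x : EuclideanSpace ℝ (Fin N),
      -(K * japaneseBracket x ^ (-(min σ N + 2 * s))) ≤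
        ∫ z, secondDiffQuot (N + 2 * s) (fun y => japaneseBracket y ^ (-σ)) x z := by
  obtain ⟨C, hC0, hC⟩ := exists_secondDiff_japaneseBracket_le N σ
  obtain ⟨D, hD0, hD⟩ := exists_setIntegral_ball_japaneseBracket_le hN hσ0 hσ
  set a : ℝ := N + 2 * s with ha
  set c₁ := ∫ z in Metric.ball (0 : EuclideanSpace ℝ (Fin N)) 1, ‖z‖ ^ (-(a - 2)) with hc₁
  set c₂ := ∫ z in (Metric.ball (0 : EuclideanSpace ℝ (Fin N)) 1)ᶜ, ‖z‖ ^ (-a) with hc₂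
  have hc₁0 : 0 ≤ c₁ := integral_nonneg fun z => by positivity
  have hc₂0 : 0 ≤ c₂ := integral_nonneg fun z => by positivity
  set K₁ : ℝ := C * ((1 / 4 : ℝ) ^ (2 - 2 * s) * c₁) + 2 * ((1 / 4 : ℝ) ^ (-(2 * s)) * c₂) with hK₁
  set K₂ : ℝ := 2 * (1 / 4 : ℝ) ^ (-a) * D with hK₂
  have hK₁0 : 0 ≤ K₁ := by positivity
  refine ⟨K₁ + K₂, by positivity, fun x => ?_⟩
  set r := japaneseBracket x with hr
  have hr1 : 1 ≤ r := one_le_japaneseBracket x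
  have hr0 : 0 < r := japaneseBracket_pos x
  set u : EuclideanSpace ℝ (Fin N) → ℝ := fun y => japaneseBracket y ^ (-σ) with hu
  have hu0 : ∀ y, 0 ≤ u y := fun y => Real.rpow_nonneg (japaneseBracket_pos y).le _
  set B := Metric.ball (0 : EuclideanSpace ℝ (Fin N)) (r / 4) with hB
  have hBm : MeasurableSet B := Metric.isOpen_ball.measurableSet
  set I : EuclideanSpace ℝ (Fin N) → ℝ := (Metric.ball 0 r).indicator u with hI
  have hI0 : ∀ y, 0 ≤ I y := fun y => Set.indicator_nonneg (fun y _ => hu0 y) y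
  have hIint : Integrable I := by
    rw [hI, integrable_indicator_iff Metric.isOpen_ball.measurableSet]
    exact ((continuous_japaneseBracket_rpow (-σ)).continuousOn.integrableOn_compact
      (isCompact_closedBall 0 r)).mono_set Metric.ball_subset_closedBall
  set F₁ : EuclideanSpace ℝ (Fin N) → ℝ := B.indicator fun z => ‖z‖ ^ (-(a - 2)) with hF₁
  set F₂ : EuclideanSpace ℝ (Fin N) → ℝ := Bᶜ.indicator fun z => ‖z‖ ^ (-a) with hF₂
  have hF₁i : Integrable F₁ :=
    (integrable_indicator_iff hBm).2 (integrableOn_norm_rpow_ball hN (by linarith) _)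
  have hF₂i : Integrable F₂ :=
    (integrable_indicator_iff hBm.compl).2
      (integrableOn_norm_rpow_compl_ball (by linarith) (by positivity))
  have hpt : ∀ z, -secondDiffQuot a u x z ≤ C * r ^ (-σ - 2) * F₁ z + 2 * r ^ (-σ) * F₂ z
      + (r / 4) ^ (-a) * (I (x + z) + I (x - z)) := by
    intro z
    have hIz : 0 ≤ (r / 4) ^ (-a) * (I (x + z) + I (x - z)) :=
      mul_nonneg (by positivity) (add_nonneg (hI0 _) (hI0 _))
    by_cases hz : z ∈ B
    · have hz' : ‖z‖ < r / 4 := by simpa [hB] using hz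
      have e2 : F₂ z = 0 := Set.indicator_of_notMem (by simpa using hz) _
      have e1 : F₁ z = ‖z‖ ^ (-(a - 2)) := Set.indicator_of_mem hz _
      rw [e1, e2, mul_zero, add_zero]
      refine le_add_of_le_of_nonneg ?_ hIz
      rcases eq_or_ne z 0 with rfl | hz0
      · have : secondDiffQuot a u x 0 = 0 := by simp [secondDiffQuot, two_mul]
        rw [this]; simp only [neg_zero]; positivity
      have hzp : 0 < ‖z‖ := norm_pos_iff.2 hz0
      rw [secondDiffQuot, ← neg_mul]
      have h := mul_le_mul_of_nonneg_right ((neg_le_abs _).trans (hC x z hz'.le))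
        (Real.rpow_nonneg hzp.le (-a))
      refine h.trans (le_of_eq ?_)
      rw [mul_assoc, ← Real.rpow_natCast, ← Real.rpow_add hzp]
      congr 2
      push_cast; ring
    · have hz' : r / 4 ≤ ‖z‖ := by simpa [hB] using hz
      have hzp : 0 < ‖z‖ := lt_of_lt_of_le (by positivity) hz'
      have e1 : F₁ z = 0 := Set.indicator_of_notMem hz _
      have e2 : F₂ z = ‖z‖ ^ (-a) := Set.indicator_of_mem hz _
      rw [e1, e2, mul_zero, zero_add]
      have hk : ‖z‖ ^ (-a) ≤ (r / 4) ^ (-a) :=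
        Real.rpow_le_rpow_of_nonpos (by positivity) hz' (by linarith [Nat.cast_nonneg (α := ℝ) N])
      -- Inside the ball of radius `r` the kernel is bounded; outside it the function is.
      have hone : ∀ y, u y * ‖z‖ ^ (-a) ≤ r ^ (-σ) * ‖z‖ ^ (-a) + (r / 4) ^ (-a) * I y := by
        intro y
        by_cases hy : ‖y‖ < r
        · have : I y = u y := Set.indicator_of_mem (by simpa using hy) _
          rw [this]
          have h1 := mul_le_mul_of_nonneg_left hk (hu0 y)
          have h2 : 0 ≤ r ^ (-σ) * ‖z‖ ^ (-a) := by positivity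
          linarith
        · push Not at hy
          have h1 : u y ≤ r ^ (-σ) :=
            Real.rpow_le_rpow_of_nonpos hr0 (hy.trans (norm_le_japaneseBracket y)) (by linarith)
          have h2 := mul_le_mul_of_nonneg_right h1 (Real.rpow_nonneg hzp.le (-a))
          have h3 : 0 ≤ (r / 4) ^ (-a) * I y := mul_nonneg (by positivity) (hI0 y)
          linarith
      have h1 := hone (x + z)
      have h2 := hone (x - z)
      have h3 : 0 ≤ u x * ‖z‖ ^ (-a) := mul_nonneg (hu0 x) (by positivity)
      rw [secondDiffQuot]
      linarith
  have hIa : Integrable fun z => I (x + z) := hIint.comp_add_left x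
  have hIs : Integrable fun z => I (x - z) := hIint.comp_sub_left x
  have hmono := integral_mono
    (integrable_secondDiffQuot_japaneseBracket hN hs hs1 hσ0.le x).neg
    (((hF₁i.const_mul (C * r ^ (-σ - 2))).add (hF₂i.const_mul (2 * r ^ (-σ)))).add
      ((hIa.add hIs).const_mul ((r / 4) ^ (-a)))) hpt
  have e1 : ∫ z, F₁ z = (r / 4) ^ (2 - 2 * s) * c₁ := by
    rw [hF₁, integral_indicator hBm, setIntegral_ball_norm_rpow _ (by positivity)]
    congr 2
    rw [ha]; ring
  have e2 : ∫ z, F₂ z = (r / 4) ^ (-(2 * s)) * c₂ := by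
    rw [hF₂, integral_indicator hBm.compl, setIntegral_compl_ball_norm_rpow _ (by positivity)]
    congr 2
    rw [ha]; ring
  have e3 : ∫ y, I y ≤ D * r ^ ((N : ℝ) - min σ N) := by
    rw [hI, integral_indicator Metric.isOpen_ball.measurableSet]
    exact hD r hr1
  have e4 : ∫ z, (C * r ^ (-σ - 2) * F₁ z + 2 * r ^ (-σ) * F₂ z
      + (r / 4) ^ (-a) * (I (x + z) + I (x - z)))
      = C * r ^ (-σ - 2) * ((r / 4) ^ (2 - 2 * s) * c₁)
        + 2 * r ^ (-σ) * ((r / 4) ^ (-(2 * s)) * c₂)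
        + (r / 4) ^ (-a) * ((∫ y, I y) + ∫ y, I y) := by
    have g₁ : Integrable fun z => C * r ^ (-σ - 2) * F₁ z := hF₁i.const_mul _
    have g₂ : Integrable fun z => 2 * r ^ (-σ) * F₂ z := hF₂i.const_mul _
    have g₃ : Integrable fun z => (r / 4) ^ (-a) * (I (x + z) + I (x - z)) :=
      (hIa.add hIs).const_mul _
    refine (integral_add (g₁.add g₂) g₃).trans ?_
    have h₁ := integral_add g₁ g₂
    have h₂ := integral_add hIa hIs
    simp only [Pi.add_apply] at h₁ h₂ ⊢
    rw [h₁, integral_const_mul, integral_const_mul, integral_const_mul, h₂,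
      integral_add_left_eq_self, integral_sub_left_eq_self, e1, e2]
  have hmono' : -∫ z, secondDiffQuot a u x z ≤ C * r ^ (-σ - 2) * ((r / 4) ^ (2 - 2 * s) * c₁)
        + 2 * r ^ (-σ) * ((r / 4) ^ (-(2 * s)) * c₂)
        + (r / 4) ^ (-a) * ((∫ y, I y) + ∫ y, I y) := by
    rw [← e4, ← integral_neg]
    exact hmono
  have hq : ∀ c : ℝ, (r / 4) ^ c = r ^ c * (1 / 4 : ℝ) ^ c := fun c => by
    rw [← Real.mul_rpow hr0.le (by norm_num)]; congr 1; ring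
  have f1 : C * r ^ (-σ - 2) * ((r / 4) ^ (2 - 2 * s) * c₁)
        + 2 * r ^ (-σ) * ((r / 4) ^ (-(2 * s)) * c₂) = K₁ * r ^ (-(σ + 2 * s)) := by
    have g1 : r ^ (-(σ + 2 * s)) = r ^ (-σ - 2) * r ^ (2 - 2 * s) := by
      rw [← Real.rpow_add hr0]; congr 1; ring
    have g2 : r ^ (-(σ + 2 * s)) = r ^ (-σ) * r ^ (-(2 * s)) := by
      rw [← Real.rpow_add hr0]; congr 1; ring
    rw [hK₁, add_mul, hq, hq]
    nth_rewrite 1 [g1]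
    rw [g2]
    ring
  have f2 : (r / 4) ^ (-a) * ((∫ y, I y) + ∫ y, I y) ≤ K₂ * r ^ (-(min σ N + 2 * s)) := by
    have g : r ^ (-(min σ N + 2 * s)) = r ^ (-a) * r ^ ((N : ℝ) - min σ N) := by
      rw [← Real.rpow_add hr0]; congr 1; rw [ha]; ring
    have h := mul_le_mul_of_nonneg_left (add_le_add e3 e3)
      (Real.rpow_nonneg (show (0 : ℝ) ≤ r / 4 by positivity) (-a))
    refine h.trans (le_of_eq ?_)
    rw [hq, g, hK₂]; ring
  have f3 : K₁ * r ^ (-(σ + 2 * s)) ≤ K₁ * r ^ (-(min σ N + 2 * s)) :=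
    mul_le_mul_of_nonneg_left (Real.rpow_le_rpow_of_exponent_le hr1
      (by linarith [min_le_left σ (N : ℝ)])) hK₁0
  rw [add_mul]
  linarith

/-! ### The scaled profile: its weighted integrability, gradient and fractional Laplacian. -/

lemma fracConst_nonneg (N : ℕ) {s : ℝ} (hs : 0 < s) (hs1 : s < 1) : 0 ≤ fracConst N s := by
  have h1 : 0 < Real.Gamma ((N : ℝ) / 2 + s) := Real.Gamma_pos_of_pos (by positivity)
  have h2 : 0 < Real.Gamma (1 - s) := Real.Gamma_pos_of_pos (by linarith)
  have := Real.pi_pos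
  unfold fracConst
  positivity

lemma memL2s_of_bounded {N : ℕ} {s : ℝ} (hs : 0 < s) {u : EuclideanSpace ℝ (Fin N) → ℝ}
    (hu : Continuous u) {M : ℝ} (hM : ∀ y, |u y| ≤ M) : MemL2s s u := by
  set a : ℝ := N + 2 * s with ha
  have ha0 : 0 < a := by positivity
  have h0 : Integrable (fun z : EuclideanSpace ℝ (Fin N) => (1 + ‖z‖) ^ (-a)) :=
    integrable_one_add_norm (by simpa using (by linarith : (N : ℝ) < a))
  refine (h0.const_mul (M * 2 ^ a)).mono' ?_ (ae_of_all _ fun x => ?_)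
  · have := hu.measurable
    exact Measurable.aestronglyMeasurable (by fun_prop)
  · have hM0 : 0 ≤ M := (abs_nonneg _).trans (hM x)
    have hx := norm_nonneg x
    have h1 : (1 + ‖x‖) ^ a ≤ 2 ^ a * (1 + ‖x‖ ^ a) := by
      have hmax : (max 1 ‖x‖) ^ a ≤ 1 + ‖x‖ ^ a := by
        rcases max_cases 1 ‖x‖ with h | h
        · rw [h.1, Real.one_rpow]; linarith [Real.rpow_nonneg hx a]
        · rw [h.1]; linarith
      refine le_trans ?_ (mul_le_mul_of_nonneg_left hmax (by positivity))
      rw [← Real.mul_rpow two_pos.le (by positivity)]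
      exact Real.rpow_le_rpow (by positivity)
        (by linarith [le_max_left 1 ‖x‖, le_max_right 1 ‖x‖]) ha0.le
    rw [Real.norm_eq_abs, abs_div, abs_of_pos (a := 1 + ‖x‖ ^ a) (by positivity),
      Real.rpow_neg (by positivity), ← div_eq_mul_inv,
      div_le_div_iff₀ (by positivity) (by positivity), mul_assoc]
    exact mul_le_mul (hM x) h1 (by positivity) hM0

/-- The scaled profile `A ⟨x / R⟩ ^ (-σ)`. -/
noncomputable def bracketProfile {N : ℕ} (A R σ : ℝ) (x : EuclideanSpace ℝ (Fin N)) : ℝ :=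
  A * japaneseBracket (R⁻¹ • x) ^ (-σ)

lemma continuous_bracketProfile {N : ℕ} (A R σ : ℝ) :
    Continuous (bracketProfile (N := N) A R σ) :=
  continuous_const.mul ((continuous_japaneseBracket_rpow (-σ)).comp (continuous_const_smul _))

lemma bracketProfile_pos {N : ℕ} {A : ℝ} (hA : 0 < A) (R σ : ℝ) (x : EuclideanSpace ℝ (Fin N)) :
    0 < bracketProfile A R σ x :=
  mul_pos hA (Real.rpow_pos_of_pos (japaneseBracket_pos _) _)

lemma abs_bracketProfile_le {N : ℕ} {A : ℝ} (hA : 0 < A) (R : ℝ) {σ : ℝ} (hσ : 0 ≤ σ)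
    (x : EuclideanSpace ℝ (Fin N)) : |bracketProfile A R σ x| ≤ A := by
  rw [abs_of_pos (bracketProfile_pos hA R σ x)]
  exact mul_le_of_le_one_right hA.le (japaneseBracket_rpow_neg_le_one hσ _)

lemma bracketProfile_eq {N : ℕ} (A R σ : ℝ) (x : EuclideanSpace ℝ (Fin N)) :
    bracketProfile A R σ x = A * (1 + (R⁻¹) ^ 2 * ‖x‖ ^ 2) ^ (-σ / 2) := by
  rw [bracketProfile, japaneseBracket_rpow, norm_smul, mul_pow, Real.norm_eq_abs, sq_abs]

lemma contDiff_bracketProfile {N : ℕ} (A R σ : ℝ) :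
    ContDiff ℝ 2 (bracketProfile (N := N) A R σ) := by
  have : bracketProfile (N := N) A R σ
      = fun x => A * (1 + (R⁻¹) ^ 2 * ‖x‖ ^ 2) ^ (-σ / 2) := funext (bracketProfile_eq A R σ)
  rw [this]
  refine contDiff_const.mul (ContDiff.rpow_const_of_ne ?_ fun x => by positivity)
  exact contDiff_const.add (contDiff_const.mul (contDiff_norm_sq ℝ))

lemma norm_gradient_bracketProfile {N : ℕ} {A R σ : ℝ} (hA : 0 < A) (hR : 0 < R) (hσ : 0 < σ)
    (x : EuclideanSpace ℝ (Fin N)) :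
    ‖gradient (bracketProfile A R σ) x‖ =
      A * R⁻¹ * σ * (‖R⁻¹ • x‖ * japaneseBracket (R⁻¹ • x) ^ (-σ - 2)) := by
  have hd : HasFDerivAt (bracketProfile (N := N) A R σ)
      (A • (((-σ / 2) * (1 + (R⁻¹) ^ 2 * ‖x‖ ^ 2) ^ (-σ / 2 - 1)) •
        ((R⁻¹) ^ 2 • (2 • innerSL ℝ x)))) x := by
    have : bracketProfile (N := N) A R σ
      = fun x => A * (1 + (R⁻¹) ^ 2 * ‖x‖ ^ 2) ^ (-σ / 2) := funext (bracketProfile_eq A R σ)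
    rw [this]
    have h1 := ((hasStrictFDerivAt_norm_sq x).hasFDerivAt.const_mul ((R⁻¹) ^ 2)).const_add 1
    exact (h1.rpow_const (Or.inl (by positivity))).const_mul A
  rw [gradient, LinearIsometryEquiv.norm_map, hd.fderiv]
  have e : (1 + (R⁻¹) ^ 2 * ‖x‖ ^ 2) ^ (-σ / 2 - 1) = japaneseBracket (R⁻¹ • x) ^ (-σ - 2) := by
    rw [japaneseBracket_rpow, norm_smul, mul_pow, Real.norm_eq_abs, sq_abs]
    congr 1; ring
  rw [e]
  have hj := Real.rpow_nonneg (japaneseBracket_pos (R⁻¹ • x)).le (-σ - 2)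
  simp only [norm_smul, ← Nat.cast_smul_eq_nsmul ℝ 2, innerSL_apply_norm,
    Real.norm_eq_abs, abs_mul, abs_of_pos hA,
    abs_of_nonneg hj, abs_of_pos (inv_pos.2 hR), abs_pow, abs_div, abs_neg, abs_of_pos hσ, abs_two,
    Nat.cast_ofNat]
  ring

lemma secondDiffQuot_bracketProfile {N : ℕ} {A R σ a : ℝ} (hR : 0 < R)
    (x z : EuclideanSpace ℝ (Fin N)) :
    secondDiffQuot a (bracketProfile A R σ) x z = A * R ^ (-a) *
      secondDiffQuot a (fun y => japaneseBracket y ^ (-σ)) (R⁻¹ • x) (R⁻¹ • z) := by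
  have h : R ^ (-a) * ‖R⁻¹ • z‖ ^ (-a) = ‖z‖ ^ (-a) := by
    rw [← Real.mul_rpow hR.le (norm_nonneg _), norm_smul, Real.norm_of_nonneg (by positivity),
      mul_inv_cancel_left₀ hR.ne']
  simp only [secondDiffQuot, bracketProfile, smul_add, smul_sub]
  rw [← h]
  ring

lemma exists_hasFracLaplacianAt_bracketProfile {N : ℕ} (hN : 2 ≤ N) {s σ : ℝ}
    (hs : 0 < s) (hs1 : s < 1) (hσ0 : 0 < σ) (hσ : σ ≠ N) :
    ∃ K : ℝ, 0 ≤ K ∧ ∀ A R : ℝ, 0 < A → 0 < R → ∀ x : EuclideanSpace ℝ (Fin N),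
      ∃ v : ℝ, HasFracLaplacianAt s (bracketProfile A R σ) v x ∧
        -(A * R ^ (-(2 * s)) * K * japaneseBracket (R⁻¹ • x) ^ (-(min σ N + 2 * s))) ≤ v := by
  obtain ⟨K, hK0, hK⟩ := exists_integral_secondDiffQuot_japaneseBracket_ge hN hs hs1 hσ0 hσ
  have hF := fracConst_nonneg N hs hs1
  refine ⟨fracConst N s * K / 2, by positivity, fun A R hA hR x => ?_⟩
  have hint : Integrable (secondDiffQuot (N + 2 * s) (bracketProfile A R σ) x) :=
    (((integrable_secondDiffQuot_japaneseBracket hN hs hs1 hσ0.le (R⁻¹ • x)).comp_smul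
      (inv_ne_zero hR.ne')).const_mul (A * R ^ (-((N : ℝ) + 2 * s)))).congr
      (ae_of_all _ fun z => (secondDiffQuot_bracketProfile hR x z).symm)
  refine ⟨_, hasFracLaplacianAt_of_secondDiffQuot hs (continuous_bracketProfile A R σ)
    (abs_bracketProfile_le hA R hσ0.le) hint, ?_⟩
  simp only [secondDiffQuot_bracketProfile hR]
  rw [integral_const_mul, Measure.integral_comp_inv_smul_of_nonneg _ _ hR.le]
  simp only [finrank_euclideanSpace, Fintype.card_fin, smul_eq_mul]
  set I := ∫ z, secondDiffQuot (N + 2 * s) (fun y => japaneseBracket y ^ (-σ)) (R⁻¹ • x) z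
  have h := hK (R⁻¹ • x)
  have e : R ^ (-((N : ℝ) + 2 * s)) * R ^ N = R ^ (-(2 * s)) := by
    rw [← Real.rpow_natCast, ← Real.rpow_add hR]; congr 1; ring
  have h2 := mul_le_mul_of_nonneg_left h
    (show 0 ≤ fracConst N s * A * R ^ (-(2 * s)) / 2 by positivity)
  refine le_trans (le_of_eq ?_) (h2.trans (le_of_eq ?_))
  · ring
  · rw [← e]; ring

/-! ### Reduction to constants, and choice of amplitude and scale. -/

/-- The two exponent conditions let the common factor `⟨y⟩^(-(σ+1)q)` be divided out. The gradient
vanishes at the origin, so `κ` records how far `|y|` falls below `⟨y⟩` outside the ball; this is the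
only use of `|x| ≥ R₀`. `K` is fixed before `A`, `R` and `λ`, so these may be chosen in terms of it.
-/
lemma exists_supersolution_of_amplitude {N : ℕ} (hN : 2 ≤ N) {s σ : ℝ}
    (hs : 0 < s) (hs1 : s < 1) (hσ0 : 0 < σ) (hσ : σ ≠ N) :
    ∃ K : ℝ, 0 ≤ K ∧ ∀ p q lam R₀ R A κ : ℝ, 0 < q → 0 ≤ lam → 0 < R₀ → 0 < R → 0 < A → 0 < κ →
      (∀ t : ℝ, R₀ / R ≤ t → κ ^ 2 * (1 + t ^ 2) ≤ t ^ 2) →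
      (σ + 1) * q ≤ min σ N + 2 * s → (σ + 1) * q ≤ σ * p →
      A * R ^ (-(2 * s)) * K + lam * A ^ p ≤ (A * R⁻¹ * σ * κ) ^ q →
      ExistsPosBddSupersolution N s p q lam R₀ := by
  obtain ⟨K, hK0, hK⟩ := exists_hasFracLaplacianAt_bracketProfile hN hs hs1 hσ0 hσ
  refine ⟨K, hK0, fun p q lam R₀ R A κ hq hlam hR₀ hR hA hκ ht h1 h2 hmain => ?_⟩
  refine ⟨bracketProfile A R σ, bracketProfile_pos hA R σ,
    ⟨A, fun x => (le_abs_self _).trans (abs_bracketProfile_le hA R hσ0.le x)⟩,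
    fun x _ => (contDiff_bracketProfile A R σ).contDiffAt,
    memL2s_of_bounded hs (continuous_bracketProfile A R σ) (abs_bracketProfile_le hA R hσ0.le),
    fun x hx => ?_⟩
  obtain ⟨v, hv, hvb⟩ := hK A R hA hR x
  refine ⟨v, hv, ?_⟩
  have hx' : R₀ ≤ ‖x‖ := by simpa using hx
  rw [norm_gradient_bracketProfile hA hR hσ0]
  simp only [bracketProfile]
  set y := R⁻¹ • x with hy
  set r := japaneseBracket y with hr
  have hr0 : 0 < r := japaneseBracket_pos y
  have hr1 : 1 ≤ r := one_le_japaneseBracket y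
  have hyn : R₀ / R ≤ ‖y‖ := by
    rw [hy, norm_smul, Real.norm_of_nonneg (by positivity), div_eq_inv_mul]
    exact mul_le_mul_of_nonneg_left hx' (by positivity)
  have hκr : κ * r ≤ ‖y‖ := by
    refine le_of_sq_le_sq ?_ (norm_nonneg y)
    rw [mul_pow, japaneseBracket_sq]
    exact ht _ hyn
  set e := r ^ (-((σ + 1) * q)) with he
  have he0 : 0 < e := Real.rpow_pos_of_pos hr0 _
  have b1 : r ^ (-(min σ N + 2 * s)) ≤ e := Real.rpow_le_rpow_of_exponent_le hr1 (by linarith)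
  have b2 : (A * r ^ (-σ)) ^ p ≤ A ^ p * e := by
    rw [Real.mul_rpow hA.le (by positivity), ← Real.rpow_mul hr0.le]
    exact mul_le_mul_of_nonneg_left
      (Real.rpow_le_rpow_of_exponent_le hr1 (by linarith)) (by positivity)
  have b3 : (A * R⁻¹ * σ * κ) ^ q * e ≤ (A * R⁻¹ * σ * (‖y‖ * r ^ (-σ - 2))) ^ q := by
    have : e = (r ^ (-σ - 1)) ^ q := by
      rw [he, ← Real.rpow_mul hr0.le]; congr 1; ring
    rw [this, ← Real.mul_rpow (by positivity) (by positivity)]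
    refine Real.rpow_le_rpow (by positivity) ?_ hq.le
    rw [mul_assoc]
    refine mul_le_mul_of_nonneg_left ?_ (by positivity)
    have : r ^ (-σ - 1) = r * r ^ (-σ - 2) := by
      rw [← Real.rpow_one_add' hr0.le (by linarith)]; congr 1; ring
    rw [this, ← mul_assoc]
    exact mul_le_mul_of_nonneg_right hκr (by positivity)
  have c1 : A * R ^ (-(2 * s)) * K * r ^ (-(min σ N + 2 * s)) ≤ A * R ^ (-(2 * s)) * K * e :=
    mul_le_mul_of_nonneg_left b1 (by positivity)
  have c2 := mul_le_mul_of_nonneg_left b2 hlam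
  have c3 := mul_le_mul_of_nonneg_right hmain he0.le
  rw [add_mul] at c3
  linarith

lemma exists_norm_comparison {R₀ : ℝ} (hR₀ : 0 < R₀) :
    ∃ κ : ℝ, 0 < κ ∧ ∀ t : ℝ, R₀ / 1 ≤ t → κ ^ 2 * (1 + t ^ 2) ≤ t ^ 2 := by
  refine ⟨R₀ / Real.sqrt (1 + R₀ ^ 2), by positivity, fun t ht => ?_⟩
  rw [div_one] at ht
  rw [div_pow, Real.sq_sqrt (by positivity), div_mul_eq_mul_div, div_le_iff₀ (by positivity)]
  nlinarith [pow_le_pow_left₀ hR₀.le ht 2]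

lemma existsPosBddSupersolution_of_ne_one {N : ℕ} (hN : 2 ≤ N) {s σ : ℝ}
    (hs : 0 < s) (hs1 : s < 1) (hσ0 : 0 < σ) (hσ : σ ≠ N) {p q : ℝ} (hq : 0 < q) (hq1 : q ≠ 1)
    (h1 : (σ + 1) * q ≤ min σ N + 2 * s) (h2 : (σ + 1) * q ≤ σ * p) {R₀ : ℝ} (hR₀ : 0 < R₀) :
    ∃ lam₀ : ℝ, 0 < lam₀ ∧ ∀ lam : ℝ, 0 < lam → lam < lam₀ →
      ExistsPosBddSupersolution N s p q lam R₀ := by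
  obtain ⟨K, hK0, hK⟩ := exists_supersolution_of_amplitude hN hs hs1 hσ0 hσ
  obtain ⟨κ, hκ, hκt⟩ := exists_norm_comparison hR₀
  set c := (σ * κ) ^ q with hc
  have hc0 : 0 < c := by positivity
  -- With `A^(q-1) = B`, half of the gradient term pays for the diffusion and the other half is kept
  -- for `λ A^p`. The `+ 1` keeps `B` positive when `K = 0`.
  set B := 2 * K / c + 1 with hB
  have hB0 : 0 < B := by positivity
  set A := B ^ (1 / (q - 1)) with hA
  have hA0 : 0 < A := by positivity
  have hAq : A ^ (q - 1) = B := by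
    rw [hA, ← Real.rpow_mul hB0.le, one_div_mul_cancel (sub_ne_zero.2 hq1), Real.rpow_one]
  have hAK : A * K ≤ A ^ q * c / 2 := by
    have e : A ^ q = A * B := by
      rw [← hAq, ← Real.rpow_one_add' hA0.le (by simpa using hq.ne')]; congr 1; ring
    have hBc : 2 * K ≤ B * c := by
      rw [hB, add_mul, div_mul_cancel₀ _ hc0.ne']; linarith
    rw [e]
    nlinarith [mul_le_mul_of_nonneg_left hBc hA0.le]
  refine ⟨A ^ (q - p) * c / 2, by positivity, fun lam hlam hlt => ?_⟩
  refine hK p q lam R₀ 1 A κ hq hlam.le hR₀ one_pos hA0 hκ hκt h1 h2 ?_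
  have e1 : lam * A ^ p ≤ A ^ q * c / 2 := by
    have : A ^ q = A ^ (q - p) * A ^ p := by rw [← Real.rpow_add hA0]; congr 1; ring
    rw [this]
    have := mul_le_mul_of_nonneg_right hlt.le (Real.rpow_nonneg hA0.le p)
    linarith
  have e2 : (A * 1⁻¹ * σ * κ) ^ q = A ^ q * c := by
    rw [hc, ← Real.mul_rpow hA0.le (by positivity)]; congr 1; ring
  rw [e2, Real.one_rpow, mul_one]
  linarith

lemma existsPosBddSupersolution_of_lt_one {N : ℕ} (hN : 2 ≤ N) {s σ : ℝ}
    (hs : 0 < s) (hs1 : s < 1) (hσ0 : 0 < σ) (hσ : σ ≠ N) {p q : ℝ} (hq : 0 < q) (hq1 : q < 1)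
    (hqp : q < p)
    (h1 : (σ + 1) * q ≤ min σ N + 2 * s) (h2 : (σ + 1) * q ≤ σ * p) {R₀ : ℝ} (hR₀ : 0 < R₀)
    {lam : ℝ} (hlam : 0 < lam) :
    ExistsPosBddSupersolution N s p q lam R₀ := by
  obtain ⟨K, hK0, hK⟩ := exists_supersolution_of_amplitude hN hs hs1 hσ0 hσ
  obtain ⟨κ, hκ, hκt⟩ := exists_norm_comparison hR₀
  set c := (σ * κ) ^ q with hc
  have hc0 : 0 < c := by positivity
  have hpow : ∀ b : ℝ, 0 < b → Tendsto (fun A : ℝ => A ^ b) (𝓝[>] 0) (𝓝 0) := fun b hb => by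
    have := (Real.continuousAt_rpow_const 0 b (Or.inr hb.le)).tendsto
    rw [Real.zero_rpow hb.ne'] at this
    exact this.mono_left nhdsWithin_le_nhds
  -- This is the left side of the inequality between constants divided by `A^q`; the right side
  -- becomes the fixed positive `c`.
  have hlim : Tendsto (fun A : ℝ => A ^ (1 - q) * K + lam * A ^ (p - q)) (𝓝[>] 0) (𝓝 0) := by
    simpa using ((hpow (1 - q) (by linarith)).mul_const K).add
      ((hpow (p - q) (by linarith)).const_mul lam)
  obtain ⟨A, hAc, hA0⟩ := ((hlim.eventually_lt_const hc0).and self_mem_nhdsWithin).exists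
  replace hA0 : 0 < A := hA0
  refine hK p q lam R₀ 1 A κ hq hlam.le hR₀ one_pos hA0 hκ hκt h1 h2 ?_
  have e2 : (A * 1⁻¹ * σ * κ) ^ q = A ^ q * c := by
    rw [hc, ← Real.mul_rpow hA0.le (by positivity)]; congr 1; ring
  have e3 : A = A ^ q * A ^ (1 - q) := by
    rw [← Real.rpow_add hA0, add_sub_cancel, Real.rpow_one]
  have e4 : A ^ p = A ^ q * A ^ (p - q) := by
    rw [← Real.rpow_add hA0, add_sub_cancel]
  have := mul_le_mul_of_nonneg_left hAc.le (Real.rpow_nonneg hA0.le q)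
  rw [e2, Real.one_rpow, mul_one, e4]
  nth_rewrite 1 [e3]
  linarith

/-- Here `A` cancels between diffusion and gradient, and `R^(-2s)` against `R⁻¹` gains a factor
`R^(1-2s)`. The scale `R` depends on `K`, `σ` and `s` only, so the threshold precedes `p` and `λ`.
-/
lemma existsPosBddSupersolution_one {N : ℕ} (hN : 2 ≤ N) {s σ : ℝ}
    (hs : 1 < 2 * s) (hs1 : s < 1) (hσ0 : 0 < σ) (hσ : σ ≠ N) (h1 : σ + 1 ≤ min σ N + 2 * s) :
    ∃ R₁ : ℝ, 0 < R₁ ∧ ∀ R₀ : ℝ, R₁ < R₀ → ∀ p : ℝ, 1 < p → σ + 1 ≤ σ * p →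
      ∀ lam : ℝ, 0 < lam → ExistsPosBddSupersolution N s p 1 lam R₀ := by
  obtain ⟨K, hK0, hK⟩ := exists_supersolution_of_amplitude hN (by linarith) hs1 hσ0 hσ
  set B := 4 * K / σ + 1 with hB
  have hB0 : 0 < B := by positivity
  set R := B ^ (1 / (2 * s - 1)) with hR
  have hR0 : 0 < R := by positivity
  have hRs : R ^ (2 * s - 1) = B := by
    rw [hR, ← Real.rpow_mul hB0.le, one_div_mul_cancel (by linarith), Real.rpow_one]
  have hRK : R ^ (-(2 * s)) * K ≤ R⁻¹ * (σ / 4) := by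
    have e : R⁻¹ = R ^ (-(2 * s)) * B := by
      rw [← hRs, ← Real.rpow_add hR0, ← Real.rpow_neg_one]; congr 1; ring
    have hBσ : 4 * K ≤ B * σ := by
      rw [hB, add_mul, div_mul_cancel₀ _ hσ0.ne']; linarith
    rw [e, mul_assoc]
    exact mul_le_mul_of_nonneg_left (by linarith) (by positivity)
  refine ⟨R, hR0, fun R₀ hR₀ p hp h2 lam hlam => ?_⟩
  -- With `κ = 1/2`, available because `R₀ > R` gives `|y| ≥ 1`, the gradient coefficient is `A R⁻¹
  -- σ/2`. Diffusion takes one half of it; `λ A^(p-1) = R⁻¹ σ/4` spends the other.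
  set D := R⁻¹ * (σ / 4) / lam with hD
  have hD0 : 0 < D := by positivity
  set A := D ^ (1 / (p - 1)) with hA
  have hA0 : 0 < A := by positivity
  have hAp : A ^ p = A * D := by
    have : A ^ (p - 1) = D := by
      rw [hA, ← Real.rpow_mul hD0.le, one_div_mul_cancel (by linarith), Real.rpow_one]
    rw [← this, ← Real.rpow_one_add' hA0.le (by linarith)]; congr 1; ring
  refine hK p 1 lam R₀ R A (1 / 2) one_pos hlam.le (hR0.trans hR₀) hR0 hA0 (by norm_num)
    (fun t ht => ?_) (by linarith) (by linarith) ?_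
  · have : 1 ≤ t := ((one_le_div hR0).2 hR₀.le).trans ht
    nlinarith
  · have e : lam * A ^ p = A * (R⁻¹ * (σ / 4)) := by
      rw [hAp, hD]; field_simp
    rw [e, Real.rpow_one]
    have := mul_le_mul_of_nonneg_left hRK hA0.le
    linarith

/-! ### Choice of the decay exponent in each regime. -/

theorem theorem3 (N : ℕ) (s : ℝ) (hs : 1 < 2 * s) (hs1 : s < 1) (hN : 2 * s < (N : ℝ)) :
    -- (i)
    (∀ q : ℝ, 0 < q → q < 1 →
      ∀ R₀ : ℝ, 0 < R₀ → ∀ lam : ℝ, 0 < lam →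
        ExistsPosBddSupersolution N s ((N : ℝ) / ((N : ℝ) - 2 * s)) q lam R₀) ∧
    -- (ii)
    (∃ R₁ : ℝ, 0 < R₁ ∧ ∀ R₀ : ℝ, R₁ < R₀ → ∀ lam : ℝ, 0 < lam →
        ExistsPosBddSupersolution N s ((N : ℝ) / ((N : ℝ) - 2 * s)) 1 lam R₀) ∧
    -- (iii)
    (∀ q : ℝ, 1 < q → q ≤ (N : ℝ) / ((N : ℝ) + 1 - 2 * s) →
      ∀ R₀ : ℝ, 0 < R₀ → ∃ lam₀ : ℝ, 0 < lam₀ ∧ ∀ lam : ℝ, 0 < lam → lam < lam₀ →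
        ExistsPosBddSupersolution N s ((N : ℝ) / ((N : ℝ) - 2 * s)) q lam R₀) ∧
    -- (iv)
    (∀ p q : ℝ, (2 * s - 1) / (2 * s - q) * q ≤ p → p < (N : ℝ) / ((N : ℝ) - 2 * s) →
      ((N : ℝ) + 2 * s) / ((N : ℝ) + 1) < q → q < (N : ℝ) / ((N : ℝ) + 1 - 2 * s) →
      ∀ R₀ : ℝ, 0 < R₀ → ∃ lam₀ : ℝ, 0 < lam₀ ∧ ∀ lam : ℝ, 0 < lam → lam < lam₀ →
        ExistsPosBddSupersolution N s p q lam R₀) ∧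
    -- (v), for exponents of the gradient other than 1
    (∀ p q : ℝ, ((N : ℝ) + 2 * s) / ((N : ℝ) + 2 * s - q) * q ≤ p →
      p < (N : ℝ) / ((N : ℝ) - 2 * s) →
      0 < q → q < ((N : ℝ) + 2 * s) / ((N : ℝ) + 1) → q ≠ 1 →
      ∀ R₀ : ℝ, 0 < R₀ → ∃ lam₀ : ℝ, 0 < lam₀ ∧ ∀ lam : ℝ, 0 < lam → lam < lam₀ →
        ExistsPosBddSupersolution N s p q lam R₀) ∧
    -- (v), for the exponent 1 of the gradient
    (∃ R₁ : ℝ, 0 < R₁ ∧ ∀ p : ℝ, ((N : ℝ) + 2 * s) / ((N : ℝ) + 2 * s - 1) ≤ p →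
      p < (N : ℝ) / ((N : ℝ) - 2 * s) →
      ∀ R₀ : ℝ, R₁ < R₀ → ∃ lam₀ : ℝ, 0 < lam₀ ∧ ∀ lam : ℝ, 0 < lam → lam < lam₀ →
        ExistsPosBddSupersolution N s p 1 lam R₀) ∧
    -- (vi)
    (∀ p : ℝ, ((N : ℝ) + 2 * s) / (N : ℝ) < p → p < (N : ℝ) / ((N : ℝ) - 2 * s) →
      ∀ R₀ : ℝ, 0 < R₀ → ∃ lam₀ : ℝ, 0 < lam₀ ∧ ∀ lam : ℝ, 0 < lam → lam < lam₀ →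
        ExistsPosBddSupersolution N s p (((N : ℝ) + 2 * s) / ((N : ℝ) + 1)) lam R₀) := by
  have hN2 : 2 ≤ N := by
    have : (1 : ℝ) < N := hs.trans hN
    exact_mod_cast this
  have hNR : (2 : ℝ) ≤ N := by exact_mod_cast hN2
  have hs0 : 0 < s := by linarith
  have hd : 0 < (N : ℝ) - 2 * s := by linarith
  have hσN : (N : ℝ) - 2 * s ≠ N := by linarith
  have hm : min ((N : ℝ) - 2 * s) N = N - 2 * s := min_eq_left (by linarith)
  -- At critical `p` take `σ = N - 2s`: then `σ + 2s = N = σp`, and both exponent conditions become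
  -- `(N-2s+1)q ≤ N`.
  have hcrit : ((N : ℝ) - 2 * s) * ((N : ℝ) / ((N : ℝ) - 2 * s)) = N := mul_div_cancel₀ _ hd.ne'
  have hp1 : 1 < (N : ℝ) / ((N : ℝ) - 2 * s) := (one_lt_div hd).2 (by linarith)
  refine ⟨?_, ?_, ?_, ?_, ?_, ?_, ?_⟩
  · intro q hq hq1 R₀ hR₀ lam hlam
    have h : ((N : ℝ) - 2 * s + 1) * q ≤ N := by nlinarith
    exact existsPosBddSupersolution_of_lt_one hN2 hs0 hs1 hd hσN hq hq1 (hq1.trans hp1)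
      (by rw [hm]; linarith) (by rw [hcrit]; exact h) hR₀ hlam
  · obtain ⟨R₁, hR₁, h⟩ := existsPosBddSupersolution_one hN2 hs hs1 hd hσN (by rw [hm]; linarith)
    exact ⟨R₁, hR₁, fun R₀ hR₀ lam hlam => h R₀ hR₀ _ hp1 (by rw [hcrit]; linarith) lam hlam⟩
  · intro q hq1 hq R₀ hR₀
    rw [le_div_iff₀ (by linarith)] at hq
    have h : ((N : ℝ) - 2 * s + 1) * q ≤ N := by linarith
    exact existsPosBddSupersolution_of_ne_one hN2 hs0 hs1 hd hσN (by linarith) hq1.ne'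
      (by rw [hm]; linarith) (by rw [hcrit]; exact h) hR₀
  · intro p q hp hp' hq hq' R₀ hR₀
    rw [div_lt_iff₀ (by linarith)] at hq
    rw [lt_div_iff₀ (by linarith)] at hq'
    have hq1 : 1 < q := by nlinarith
    have hq2 : q < 2 * s := by nlinarith
    have ha : 0 < q - 1 := by linarith
    have hb : 0 < 2 * s - q := by linarith
    -- This `σ` solves `(σ+1)q = σ + 2s`; it lies below `N` exactly when `q > (N+2s)/(N+1)`.
    set σ := (2 * s - q) / (q - 1) with hσ
    have hσ0 : 0 < σ := by positivity
    have hσq : σ * (q - 1) = 2 * s - q := div_mul_cancel₀ _ ha.ne'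
    have hσlt : σ < N := by rw [hσ, div_lt_iff₀ ha]; linarith
    have h2 : (σ + 1) * q = σ * ((2 * s - 1) / (2 * s - q) * q) := by
      rw [hσ]; field_simp; ring
    refine existsPosBddSupersolution_of_ne_one hN2 hs0 hs1 hσ0 hσlt.ne (by linarith) hq1.ne'
      ?_ ?_ hR₀
    · rw [min_eq_left hσlt.le]; linarith
    · rw [h2]; exact mul_le_mul_of_nonneg_left hp hσ0.le
  · intro p q hp hp' hq hq' hq1 R₀ hR₀
    rw [lt_div_iff₀ (by linarith)] at hq'
    have hb : 0 < (N : ℝ) + 2 * s - q := by nlinarith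
    -- This `σ` solves `(σ+1)q = N + 2s`; it exceeds `N` exactly when `q < (N+2s)/(N+1)`.
    set σ := ((N : ℝ) + 2 * s - q) / q with hσ
    have hσq : σ * q = N + 2 * s - q := div_mul_cancel₀ _ hq.ne'
    have hσgt : (N : ℝ) < σ := by rw [hσ, lt_div_iff₀ hq]; linarith
    have hσ0 : 0 < σ := by linarith
    have h2 : (σ + 1) * q = σ * (((N : ℝ) + 2 * s) / ((N : ℝ) + 2 * s - q) * q) := by
      rw [hσ]; field_simp; ring
    refine existsPosBddSupersolution_of_ne_one hN2 hs0 hs1 hσ0 hσgt.ne' hq hq1 ?_ ?_ hR₀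
    · rw [min_eq_right hσgt.le]; linarith
    · rw [h2]; exact mul_le_mul_of_nonneg_left hp hσ0.le
  · have hσgt : (N : ℝ) < N + 2 * s - 1 := by linarith
    have hσ0 : 0 < (N : ℝ) + 2 * s - 1 := by linarith
    obtain ⟨R₁, hR₁, h⟩ := existsPosBddSupersolution_one hN2 hs hs1 hσ0 hσgt.ne'
      (by rw [min_eq_right hσgt.le]; linarith)
    -- Every `λ > 0` is admissible here, so the threshold `1` is arbitrary.
    refine ⟨R₁, hR₁, fun p hp hp' R₀ hR₀ => ⟨1, one_pos, fun lam hlam _ => ?_⟩⟩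
    have h1p : 1 < p := ((one_lt_div hσ0).2 (by linarith)).trans_le hp
    rw [div_le_iff₀ hσ0] at hp
    exact h R₀ hR₀ p h1p (by linarith) lam hlam
  · intro p hp hp' R₀ hR₀
    set q := ((N : ℝ) + 2 * s) / ((N : ℝ) + 1) with hq
    have hqN : q * (N + 1) = N + 2 * s := div_mul_cancel₀ _ (by linarith)
    have hq1 : 1 < q := (one_lt_div (by linarith)).2 (by linarith)
    rw [div_lt_iff₀ (by linarith)] at hp
    have hpq : 0 < p - q := by nlinarith
    -- The balancing exponent would be the excluded `σ = N`. As `q > 1`, any `σ < N` meets the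
    -- diffusion condition, and the strict bound on `p` leaves room for `q/(p-q) ≤ σ < N`.
    set σ := max ((N : ℝ) / 2) (q / (p - q)) with hσ
    have hσ0 : 0 < σ := lt_max_of_lt_left (by linarith)
    have hσlt : σ < N := by
      refine max_lt (by linarith) ?_
      rw [div_lt_iff₀ hpq]; linarith
    have h2 : q ≤ σ * (p - q) := (div_le_iff₀ hpq).1 (le_max_right _ _)
    refine existsPosBddSupersolution_of_ne_one hN2 hs0 hs1 hσ0 hσlt.ne (by linarith) hq1.ne'
      ?_ (by linarith) hR₀
    rw [min_eq_left hσlt.le]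
    nlinarith
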